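/- Let $p$ be a prime, $n\ge 1$, $N=p^n$, let $R$ be a commutative $\mathbb F_p$-algebra and $\lambda\in R$. For a commutative $\mathbb F_p$-algebra $R'$ and $\mu\in R'$ put $Y_s=\sum_{k=0}^{s}\binom{s}{k}\mu^kX_{T^k}$ in $R'[X_1,X_T,\dots,X_{T^{N-1}}]$, where $X_1=X_{T^0}$ and $X_{T^k}=0$ for $k\ge N$, and let $$S(A_{R'}^{(\mu)})_\Theta=R'\Bigl[X_1,X_T,\dots,X_{T^{N-1}},\tfrac1\varDelta\Bigr],\qquad \varDelta=\prod_{l=0}^{N-1}Y_l .$$ Let $A_R^{(\lambda)}=R[T]/(T^{N})$ be the Hopf algebra with comultiplication $T\mapsto T\otimes1+1\otimes T+\lambda T\otimes T$. The comultiplication of $S(A_R^{(\lambda)})_\Theta$ is the algebra map with $$X_{T^s}\mapsto\sum_{l=0}^{s}\binom sl\Bigl(\sum_{k=0}^{l}\binom lk\lambda^kX_{T^{k+s-l}}\Bigr)\otimes X_{T^l}\qquad(0\le s\le N-1),$$ and $S(A_R^{(\lambda)})_\Theta$ is a right $A_R^{(\lambda)}$-comodule algebra by $\rho=(\mathrm{id}\otimes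 j^\#)\circ(\text{comultiplication})$, where $j^\#:S(A_R^{(\lambda)})_\Theta\to A_R^{(\lambda)}$, $X_{T^s}\mapsto T^s$. Let $S(A_R^{(\lambda)})_\Theta^{\mathrm{co}A_R^{(\lambda)}}=\{a:\rho(a)=a\otimes1\}$. Over $R'=R[\Lambda,1/\Lambda]$ with $\mu=\Lambda$ define recursively, for $2\le s\le N$, $$P_{(\Lambda)}(X_T^s)=\frac1{\Lambda^s}\Bigl\{\frac{(X_1+\Lambda X_T)^sX_1}{\sum_{k=0}^{s}\binom sk\Lambda^kX_{T^k}}-X_1^s-\sum_{k=2}^{s-1}\binom sk\Lambda^kX_1^{s-k}P_{(\Lambda)}(X_T^k)\Bigr\}\in S(A^{(\Lambda)}_{R[\Lambda,1/\Lambda]})_\Theta .$$ Then for $2\le s\le N$ the element $P_{(\Lambda)}(X_T^s)$ is the image of exactly one element of $S(A^{(\Lambda)}_{R[\Lambda]})_\Theta$; let $P_{(\lambda)}(X_T^s)\in S(A_R^{(\lambda)})_\Theta$ be the image of the latter under $\Lambda\mapsto\lambda$. Moreover, $S(A_R^{(\lambda)})_\Theta^{\mathrm{co}A_R^{(\lambda)}}$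 is the $R$-subalgebra of $S(A_R^{(\lambda)})_\Theta$ generated by $X_1^{\pm1}$, $X_T^{p^n}$, $P_{(\lambda)}(X_T^s)$ for $2\le s\le p^n$, $1/(X_1^{p^n}+\lambda^{p^n}X_T^{p^n})$, and $$\frac{\sum_{k=0}^{s}\binom sk\lambda^kX_{T^k}}{(X_1+\lambda X_T)^s}\qquad\text{for }2\le s\le p^n-1 .$$ -/

import Mathlib

open scoped TensorProduct

namespace UnitGroupScheme

noncomputable section

section Ring

variable {R : Type*} [CommRing R] (lam : R) (N : ℕ)

/-- The variable `X_{T^s}` of `R[X_1, X_T, …, X_{T^{N-1}}]`, with `X_{T^s} = 0` for `s ≥ N`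
(as `T^s = 0` in `R[T]/(T^N)`). Here `X_1 = X_{T^0}`. -/
def polyX (R : Type*) [CommRing R] (N s : ℕ) : MvPolynomial (Fin N) R :=
  if h : s < N then MvPolynomial.X ⟨s, h⟩ else 0

/-- `∑_{k=0}^{s} binom(s,k) λ^k X_{T^k}`. -/
def polyY (s : ℕ) : MvPolynomial (Fin N) R :=
  ∑ k ∈ Finset.range (s + 1), (s.choose k : MvPolynomial (Fin N) R) *
    MvPolynomial.C (lam ^ k) * polyX R N k

/-- The determinant `∏_{l=0}^{N-1} ∑_{k=0}^{l} binom(l,k) λ^k X_{T^k}`. -/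
def disc : MvPolynomial (Fin N) R :=
  ∏ l ∈ Finset.range N, polyY lam N l

/-- `S(A_R^{(λ)})_Θ = R[X_1, X_T, …, X_{T^{N-1}}, 1/Δ]`, with `N = p ^ n`. -/
abbrev SA : Type _ := Localization.Away (disc lam N)

/-- The algebra `A_R^{(λ)} = R[T]/(T^N)`, with `N = p ^ n`. As an algebra it does not depend on `λ`;
its Hopf algebra structure enters through the coaction below. -/
abbrev TruncPoly (R : Type*) [CommRing R] (N : ℕ) : Type _ :=
  Polynomial R ⧸ Ideal.span {(Polynomial.X ^ N : Polynomial R)}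

/-- The class of `T` in `R[T]/(T^N)`. -/
def truncT (R : Type*) [CommRing R] (N : ℕ) : TruncPoly R N :=
  Ideal.Quotient.mk _ Polynomial.X

/-- The element `X_{T^s}` of `S(A_R^{(λ)})_Θ`. -/
def X (s : ℕ) : SA lam N := algebraMap (MvPolynomial (Fin N) R) (SA lam N) (polyX R N s)

/-- The element `∑_{k=0}^{s} binom(s,k) λ^k X_{T^k}` of `S(A_R^{(λ)})_Θ`. -/
def Y (s : ℕ) : SA lam N :=
  ∑ k ∈ Finset.range (s + 1), (s.choose k : SA lam N) * algebraMap R (SA lam N) (lam ^ k) *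
    X lam N k

lemma algebraMap_polyY (s : ℕ) :
    algebraMap (MvPolynomial (Fin N) R) (SA lam N) (polyY lam N s) = Y lam N s := by
  simp only [polyY, Y, X, map_sum, map_mul, map_natCast]
  refine Finset.sum_congr rfl fun k _ => ?_
  rw [IsScalarTower.algebraMap_apply R (MvPolynomial (Fin N) R) (SA lam N),
    MvPolynomial.algebraMap_eq]

lemma disc_eq : disc lam N = ∏ l ∈ Finset.range N, polyY lam N l := rfl

lemma isUnit_disc : IsUnit (algebraMap (MvPolynomial (Fin N) R) (SA lam N) (disc lam N)) :=
  IsLocalization.Away.algebraMap_isUnit _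

lemma isUnit_Y {s : ℕ} (hs : s < N) : IsUnit (Y lam N s) := by
  rw [← algebraMap_polyY]
  refine isUnit_of_dvd_unit (map_dvd _ ?_) (isUnit_disc lam N)
  exact Finset.dvd_prod_of_mem _ (Finset.mem_range.2 hs)

/-- The comultiplication of `S(A_R^{(λ)})_Θ` on `X_{T^s}`:
`∑_l binom(s,l) (∑_k binom(l,k) λ^k X_{T^{k+s-l}}) ⊗ X_{T^l}`. -/
def comulX (s : ℕ) : SA lam N ⊗[R] SA lam N :=
  ∑ l ∈ Finset.range (s + 1), (s.choose l : SA lam N ⊗[R] SA lam N) *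
    ((∑ k ∈ Finset.range (l + 1), (l.choose k : SA lam N) * algebraMap R (SA lam N) (lam ^ k) *
      X lam N (k + (s - l))) ⊗ₜ[R] X lam N l)

/-- The comultiplication on the polynomial ring `R[X_1, X_T, …, X_{T^{N-1}}]`. -/
def comulPoly : MvPolynomial (Fin N) R →ₐ[R] SA lam N ⊗[R] SA lam N :=
  MvPolynomial.aeval fun s => comulX lam N s

/-- The `R`-linear map `R[T] → S(A_R^{(λ)})_Θ`, `T^s ↦ X_{T^s}`. -/
def linX : Polynomial R →ₗ[R] SA lam N :=
  Polynomial.lsum fun s => LinearMap.toSpanSingleton R (SA lam N) (X lam N s)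

lemma linX_X_pow (s : ℕ) : linX lam N (Polynomial.X ^ s) = X lam N s := by
  rw [← Polynomial.monomial_one_right_eq_X_pow]
  simp [linX, Polynomial.lsum_apply, Polynomial.sum_monomial_index]

lemma linX_pow (s m : ℕ) :
    linX lam N (Polynomial.X ^ m * (1 + Polynomial.C lam * Polynomial.X) ^ s) =
      ∑ k ∈ Finset.range (s + 1), (s.choose k : SA lam N) * algebraMap R (SA lam N) (lam ^ k) *
        X lam N (k + m) := by
  rw [add_comm (1 : Polynomial R), add_pow, Finset.mul_sum, map_sum]
  refine Finset.sum_congr rfl fun k _ => ?_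
  have : (Polynomial.X ^ m * ((Polynomial.C lam * Polynomial.X) ^ k * 1 ^ (s - k) *
      (s.choose k : Polynomial R)) : Polynomial R) =
      ((s.choose k : R) * lam ^ k) • Polynomial.X ^ (k + m) := by
    rw [Polynomial.smul_eq_C_mul]
    simp only [map_mul, map_natCast, map_pow]
    ring
  rw [this, map_smul, linX_X_pow, Algebra.smul_def, map_mul, map_natCast]

lemma comulX_eq (s : ℕ) :
    comulX lam N s = TensorProduct.map (linX lam N) (linX lam N)
      ((Polynomial.X ⊗ₜ[R] 1 + (1 + Polynomial.C lam * Polynomial.X) ⊗ₜ[R] Polynomial.X) ^ s) := by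
  rw [add_comm (Polynomial.X ⊗ₜ[R] (1 : Polynomial R)), add_pow, map_sum, comulX]
  refine Finset.sum_congr rfl fun l _ => ?_
  have := linX_pow lam N l (s - l)
  rw [← this, mul_comm _ ((s.choose l : ℕ) : Polynomial R ⊗[R] Polynomial R),
    ← nsmul_eq_mul, ← nsmul_eq_mul, map_nsmul, Algebra.TensorProduct.tmul_pow,
    Algebra.TensorProduct.tmul_pow, Algebra.TensorProduct.tmul_mul_tmul, TensorProduct.map_tmul,
    one_pow, mul_one, linX_X_pow, mul_comm (Polynomial.X ^ (s - l))]

lemma comulPoly_polyX {s : ℕ} (hs : s < N) : comulPoly lam N (polyX R N s) = comulX lam N s := by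
  simp [comulPoly, polyX, hs]

lemma comulPoly_polyY {s : ℕ} (hs : s < N) :
    comulPoly lam N (polyY lam N s) = Y lam N s ⊗ₜ[R] Y lam N s := by
  have hY : Y lam N s = linX lam N ((1 + Polynomial.C lam * Polynomial.X) ^ s) := by
    have := linX_pow lam N s 0
    simpa [Y] using this.symm
  have key : ((1 + Polynomial.C lam * Polynomial.X) ^ s) ⊗ₜ[R]
      ((1 + Polynomial.C lam * Polynomial.X) ^ s) =
      (1 + lam • (Polynomial.X ⊗ₜ[R] 1 +
        (1 + Polynomial.C lam * Polynomial.X) ⊗ₜ[R] Polynomial.X) :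
          Polynomial R ⊗[R] Polynomial R) ^ s := by
    rw [← Algebra.TensorProduct.tmul_pow]
    congr 1
    rw [TensorProduct.tmul_add, ← Polynomial.smul_eq_C_mul, TensorProduct.tmul_smul, smul_add,
      TensorProduct.add_tmul, Algebra.TensorProduct.one_def, TensorProduct.smul_tmul',
      TensorProduct.smul_tmul', add_assoc]
  rw [hY, ← TensorProduct.map_tmul, key, add_comm (1 : Polynomial R ⊗[R] Polynomial R), add_pow,
    map_sum, polyY, map_sum]
  refine Finset.sum_congr rfl fun k hk => ?_
  have hkN : k < N := by
    have := Finset.mem_range.1 hk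
    omega
  rw [map_mul, map_mul, map_natCast, comulPoly_polyX lam N hkN, comulX_eq, one_pow, mul_one,
    mul_comm _ ((s.choose k : ℕ) : Polynomial R ⊗[R] Polynomial R), mul_assoc, ← nsmul_eq_mul,
    ← nsmul_eq_mul, map_nsmul, smul_pow, map_smul, ← MvPolynomial.algebraMap_eq,
    AlgHom.commutes, ← Algebra.smul_def]

lemma isUnit_comulPoly_disc : IsUnit (comulPoly lam N (disc lam N)) := by
  have h0 := congrArg (comulPoly lam N) (disc_eq lam N)
  rw [map_prod] at h0
  rw [h0, IsUnit.prod_iff]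
  intro s hs
  have hs := Finset.mem_range.1 hs
  rw [comulPoly_polyY lam N hs]
  have h := isUnit_Y lam N hs
  have h1 : IsUnit (Y lam N s ⊗ₜ[R] (1 : SA lam N)) :=
    h.map (Algebra.TensorProduct.includeLeft : SA lam N →ₐ[R] SA lam N ⊗[R] SA lam N)
  have h2 : IsUnit ((1 : SA lam N) ⊗ₜ[R] Y lam N s) :=
    h.map (Algebra.TensorProduct.includeRight : SA lam N →ₐ[R] SA lam N ⊗[R] SA lam N)
  simpa using h1.mul h2

/-- The comultiplication of `S(A_R^{(λ)})_Θ`. -/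
def comul : SA lam N →ₐ[R] SA lam N ⊗[R] SA lam N :=
  IsLocalization.liftAlgHom (M := Submonoid.powers (disc lam N)) (f := comulPoly lam N) (by
    rintro ⟨_, m, rfl⟩
    simpa using (isUnit_comulPoly_disc lam N).pow m)

/-- The map `R[X_1, X_T, …, X_{T^{N-1}}] → R[T]/(T^N)`, `X_{T^s} ↦ T^s`. -/
def immersionPoly (R : Type*) [CommRing R] (N : ℕ) :
    MvPolynomial (Fin N) R →ₐ[R] TruncPoly R N :=
  MvPolynomial.aeval fun s => truncT R N ^ (s : ℕ)

lemma isUnit_immersionPoly_disc : IsUnit (immersionPoly R N (disc lam N)) := by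
  have hT : truncT R N ^ N = 0 := by
    rw [truncT, ← map_pow, Ideal.Quotient.eq_zero_iff_mem]
    exact Ideal.subset_span rfl
  have hu : IsUnit (1 + algebraMap R (TruncPoly R N) lam * truncT R N) := by
    refine IsNilpotent.isUnit_one_add ⟨N, ?_⟩
    rw [mul_pow, hT, mul_zero]
  have h0 := congrArg (immersionPoly R N) (disc_eq lam N)
  rw [map_prod] at h0
  rw [h0, IsUnit.prod_iff]
  intro s hs
  have hs := Finset.mem_range.1 hs
  suffices h : immersionPoly R N (polyY lam N s) =
      (1 + algebraMap R (TruncPoly R N) lam * truncT R N) ^ s by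
    rw [h]
    exact hu.pow s
  rw [add_comm, add_pow, polyY, map_sum]
  refine Finset.sum_congr rfl fun k hk => ?_
  have hkN : k < N := by
    have := Finset.mem_range.1 hk
    omega
  have hX : immersionPoly R N (polyX R N k) = truncT R N ^ k := by
    simp [immersionPoly, polyX, hkN]
  rw [map_mul, map_mul, map_natCast, hX, ← MvPolynomial.algebraMap_eq, AlgHom.commutes, map_pow]
  ring

/-- The map `j^# : S(A_R^{(λ)})_Θ → A_R^{(λ)}`, `X_{T^s} ↦ T^s`, of the closed immersion of
`Γ^{(λ)}` into `U(Γ^{(λ)})`. -/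
def immersion : SA lam N →ₐ[R] TruncPoly R N :=
  IsLocalization.liftAlgHom (M := Submonoid.powers (disc lam N)) (f := immersionPoly R N) (by
    rintro ⟨_, m, rfl⟩
    simpa using (isUnit_immersionPoly_disc lam N).pow m)

/-- The right coaction `ρ = (id ⊗ j^#) ∘ Δ` of `A_R^{(λ)}` on `S(A_R^{(λ)})_Θ`. -/
def coaction : SA lam N →ₐ[R] SA lam N ⊗[R] TruncPoly R N :=
  (Algebra.TensorProduct.map (AlgHom.id R (SA lam N)) (immersion lam N)).comp (comul lam N)

/-- The coinvariants `{a | ρ(a) = a ⊗ 1}`. -/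
def coinvariants : Subalgebra R (SA lam N) :=
  AlgHom.equalizer (coaction lam N) Algebra.TensorProduct.includeLeft

end Ring

section BaseChange

variable {R R' : Type*} [CommRing R] [CommRing R'] (f : R →+* R') {lam : R} {lam' : R'} (N : ℕ)

lemma map_polyX (s : ℕ) : MvPolynomial.map f (polyX R N s) = polyX R' N s := by
  unfold polyX
  split_ifs <;> simp

lemma map_disc (h : f lam = lam') : MvPolynomial.map f (disc lam N) = disc lam' N := by
  simp [disc, polyY, map_polyX, map_prod, map_sum, h]

/-- The map `S(A_R^{(λ)})_Θ → S(A_{R'}^{(λ')})_Θ`, `X_{T^s} ↦ X_{T^s}`, induced by a ring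
homomorphism `f : R → R'` with `f(λ) = λ'`. -/
def baseChange (h : f lam = lam') : SA lam N →+* SA lam' N :=
  IsLocalization.Away.lift (disc lam N)
    (g := (algebraMap (MvPolynomial (Fin N) R') (SA lam' N)).comp (MvPolynomial.map f)) (by
      rw [RingHom.comp_apply, map_disc f N h]
      exact isUnit_disc lam' N)

end BaseChange

section P

variable (R : Type*) [CommRing R] (N : ℕ)

/-- `S(A^{(Λ)})_Θ` over `R[Λ]`. -/
abbrev SAPoly : Type _ := SA (Polynomial.X : Polynomial R) N

/-- `S(A^{(Λ)})_Θ` over `R[Λ, 1/Λ]`. -/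
abbrev SALaurent : Type _ := SA (LaurentPolynomial.T 1 : LaurentPolynomial R) N

/-- The natural map from `S(A^{(Λ)})_Θ` over `R[Λ]` to the one over `R[Λ, 1/Λ]`. -/
def toSALaurent : SAPoly R N →+* SALaurent R N :=
  baseChange (Polynomial.toLaurent (R := R)) N Polynomial.toLaurent_X

variable {R} in
/-- The specialization `Λ ↦ λ`, from `S(A^{(Λ)})_Θ` over `R[Λ]` to `S(A_R^{(λ)})_Θ`. -/
def specialize (lam : R) : SAPoly R N →+* SA lam N :=
  baseChange (Polynomial.evalRingHom lam) N (Polynomial.eval_X)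

/-- The element `P_{(Λ)}(X_T^s)`, `s ≥ 2`, of `S(A^{(Λ)})_Θ` over `R[Λ, 1/Λ]`:
`Λ^{-s} { (X_1 + Λ X_T)^s X_1 / ∑_{k=0}^{s} binom(s,k) Λ^k X_{T^k} - X_1^s
  - ∑_{k=2}^{s-1} binom(s,k) Λ^k X_1^{s-k} P_{(Λ)}(X_T^k) }`. -/
def laurentP (s : ℕ) : SALaurent R N :=
  algebraMap (LaurentPolynomial R) (SALaurent R N) (LaurentPolynomial.T (-(s : ℤ))) *
    ((X (LaurentPolynomial.T 1) N 0 +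
          algebraMap (LaurentPolynomial R) (SALaurent R N) (LaurentPolynomial.T 1) *
            X (LaurentPolynomial.T 1) N 1) ^ s *
        X (LaurentPolynomial.T 1) N 0 * Ring.inverse (Y (LaurentPolynomial.T 1) N s) -
      X (LaurentPolynomial.T 1) N 0 ^ s -
      ∑ k ∈ (Finset.Ico 2 s).attach, (s.choose k : SALaurent R N) *
        algebraMap (LaurentPolynomial R) (SALaurent R N) (LaurentPolynomial.T (k : ℤ)) *
        X (LaurentPolynomial.T 1) N 0 ^ (s - (k : ℕ)) * laurentP k)
  termination_by s
  decreasing_by exact (Finset.mem_Ico.1 k.2).2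

open Classical in
/-- The element `P_{(λ)}(X_T^s)` of `S(A_R^{(λ)})_Θ`: the element `P_{(Λ)}(X_T^s)`, which lies in
`S(A^{(Λ)})_Θ` over `R[Λ]`, specialized at `Λ = λ`. (The value `0` is a placeholder for the case
that `P_{(Λ)}(X_T^s)` does not lie there.) -/
def P {R : Type*} [CommRing R] (lam : R) (N s : ℕ) : SA lam N :=
  if h : ∃ q : SAPoly R N, toSALaurent R N q = laurentP R N s then
    specialize N lam h.choose
  else 0

/-- The `R`-subalgebra of `S(A_R^{(λ)})_Θ` generated by `X_1^{±1}`, `X_T^N`,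
`P_{(λ)}(X_T^s)` for `2 ≤ s ≤ N`, `1/(X_1^N + λ^N X_T^N)` and
`(∑_{k=0}^{s} binom(s,k) λ^k X_{T^k}) / (X_1 + λ X_T)^s` for `2 ≤ s ≤ N - 1`. -/
def generated {R : Type*} [CommRing R] (lam : R) (N : ℕ) : Subalgebra R (SA lam N) :=
  Algebra.adjoin R
    ({X lam N 0, Ring.inverse (X lam N 0), X lam N 1 ^ N,
        Ring.inverse (X lam N 0 ^ N + algebraMap R (SA lam N) (lam ^ N) * X lam N 1 ^ N)} ∪
      {x | ∃ s, 2 ≤ s ∧ s ≤ N ∧ x = P lam N s} ∪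
      {x | ∃ s, 2 ≤ s ∧ s < N ∧ x = Y lam N s *
        Ring.inverse ((X lam N 0 + algebraMap R (SA lam N) lam * X lam N 1) ^ s)})

end P

end

end UnitGroupScheme

/-
Let `Φ` and `Ψ` be the families `Φ(T^s) = X_{T^s}`, `Ψ(T^s) = P(X_T^s)`, extended linearly to
polynomials, and let `χ` be the character `T ↦ X_T / X_1`. The recursion defining `P` says
`X_1 χ = Φ * Ψ` for the convolution product dual to `T ↦ T ⊗ 1 + 1 ⊗ T + λ T ⊗ T`; solving it for
`Ψ` only requires dividing by the units `Φ((1 + λT)^s)`, not by `λ`. The coaction translates both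
`Φ` and `χ` by the point `T`, so `Ψ` is coinvariant. Conversely, the listed coinvariants generate
the whole ring once `X_T` is adjoined, and `X_T^N` is one of them, so every element is a polynomial
`q(X_T)` of degree `< N` with coefficients among them. The coaction sends `X_T` to
`X_T + (X_1 + λ X_T) T`; comparing coefficients of powers of `T` shows that a coinvariant `q(X_T)`
has constant `q`.
-/

noncomputable section

open Polynomial

section Ring

lemma map_ringInverse {M N F : Type*} [MonoidWithZero M] [MonoidWithZero N] [FunLike F M N]
    [MonoidHomClass F M N] (f : F) {a : M} (ha : IsUnit a) :
    f (Ring.inverse a) = Ring.inverse (f a) := by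
  refine (ha.map f).mul_left_cancel ?_
  rw [← map_mul, Ring.mul_inverse_cancel _ ha, map_one, Ring.mul_inverse_cancel _ (ha.map f)]

lemma map_mul_ringInverse_eq {M N F G : Type*} [CommMonoidWithZero M] [CommMonoid N]
    [FunLike F M N] [MonoidHomClass F M N] [FunLike G M N] [MonoidHomClass G M N] (σ : F) (τ : G)
    {a b : M} (hb : IsUnit b) {r : N} (hσa : σ a = r * τ a) (hσb : σ b = r * τ b) :
    σ (a * Ring.inverse b) = τ (a * Ring.inverse b) := by
  have hab : a * Ring.inverse b * b = a := by
    rw [mul_assoc, Ring.inverse_mul_cancel _ hb, mul_one]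
  refine (hb.map σ).mul_right_cancel ?_
  rw [← map_mul, hab, hσa, hσb, mul_left_comm, ← map_mul, hab]

lemma add_pow_prime_pow_of_algebra {A : Type*} [CommRing A] {p : ℕ} [hp : Fact p.Prime]
    [Algebra (ZMod p) A] (x y : A) (n : ℕ) : (x + y) ^ p ^ n = x ^ p ^ n + y ^ p ^ n := by
  have h : (p : A) = 0 := by
    rw [← map_natCast (algebraMap (ZMod p) A), CharP.cast_eq_zero, map_zero]
  rw [add_pow_prime_pow_eq hp.out x y n, h]
  simp only [zero_mul, add_zero]

lemma exists_aeval_eq_of_pow_eq {B S : Type*} [CommRing B] [CommRing S] [Algebra B S] {x : S}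
    (hx : Algebra.adjoin B {x} = ⊤) {N : ℕ} (hN : N ≠ 0) {c : B} (hc : x ^ N = algebraMap B S c)
    (a : S) : ∃ q : B[X], q.natDegree < N ∧ aeval x q = a := by
  obtain ⟨q, rfl⟩ : a ∈ (aeval (R := B) x).range := by
    rw [← Algebra.adjoin_singleton_eq_range_aeval, hx]
    trivial
  have hroot : aeval x (X ^ N - C c) = 0 := by simp [hc]
  refine ⟨q %ₘ (X ^ N - C c), ?_, aeval_modByMonic_eq_self_of_root hroot⟩
  rcases subsingleton_or_nontrivial B with _ | _
  · rw [natDegree_of_subsingleton]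
    exact Nat.pos_of_ne_zero hN
  have hdeg := natDegree_X_pow_sub_C (n := N) (r := c)
  refine (natDegree_modByMonic_lt q (monic_X_pow_sub_C c hN) fun h => hN ?_).trans_eq hdeg
  rw [← hdeg, h, natDegree_one]

lemma exists_eval_eq_of_pow_mem {R S : Type*} [CommRing R] [CommRing S] [Algebra R S]
    {G : Subalgebra R S} {x : S} (hx : G ⊔ Algebra.adjoin R {x} = ⊤) {N : ℕ} (hN : N ≠ 0)
    (hc : x ^ N ∈ G) (a : S) :
    ∃ q : S[X], q.natDegree < N ∧ (∀ k, q.coeff k ∈ G) ∧ q.eval x = a := by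
  have hle : G ⊔ Algebra.adjoin R {x} ≤ (Algebra.adjoin G {x}).restrictScalars R := by
    refine sup_le (fun g hg => ?_) (Algebra.adjoin_le Algebra.subset_adjoin)
    exact Subalgebra.algebraMap_mem (Algebra.adjoin G {x}) ⟨g, hg⟩
  have htop : Algebra.adjoin G {x} = ⊤ :=
    Algebra.eq_top_iff.2 fun b => hle (hx ▸ Algebra.mem_top)
  obtain ⟨q, hqN, hq⟩ := exists_aeval_eq_of_pow_eq htop hN (c := ⟨x ^ N, hc⟩) rfl a
  refine ⟨q.map (algebraMap G S), natDegree_map_le.trans_lt hqN, fun k => ?_, ?_⟩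
  · rw [coeff_map]
    exact (q.coeff k).2
  · rw [eval_map_algebraMap, hq]

/-- Comparing coefficients of powers of `t` in `q(x + y t) = q(x)`. -/
lemma eq_C_of_map_eval_eq {S A : Type*} [CommRing S] [CommRing A] [Algebra S A] {N : ℕ} {t : A}
    (ht : ∀ q : S[X], q.natDegree < N → aeval t q = 0 → q = 0) (σ : S →+* A) {x y : S}
    (hy : IsUnit y) (hσ : σ x = algebraMap S A x + algebraMap S A y * t) {q : S[X]}
    (hqN : q.natDegree < N) (hq : ∀ k, σ (q.coeff k) = algebraMap S A (q.coeff k))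
    (hqx : σ (q.eval x) = algebraMap S A (q.eval x)) : q = C (q.eval x) := by
  obtain ⟨u, rfl⟩ := hy
  let := u.invertible
  let e := algEquivCMulXAddC (u : S) x
  have he (r : S[X]) : aeval t (e r) = aeval (σ x) r := by
    rw [algEquivCMulXAddC_apply, ← aeval_algHom_apply, hσ]
    simp [add_comm]
  have hσq : σ (q.eval x) = aeval (σ x) q := by
    simp only [eval_eq_sum_range, aeval_eq_sum_range, map_sum, map_mul, map_pow, hq,
      Algebra.smul_def]
  have hdeg : (e (q - C (q.eval x))).natDegree < N := by
    refine (natDegree_comp_le.trans ?_).trans_lt hqN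
    rw [natDegree_sub_C]
    exact mul_le_of_le_one_right' natDegree_linear_le
  have h0 : e (q - C (q.eval x)) = 0 :=
    ht _ hdeg (by rw [he, map_sub, ← hσq, hqx, aeval_C, sub_self])
  exact sub_eq_zero.1 ((map_eq_zero_iff e e.injective).1 h0)

end Ring

section Umbral

variable {A B : Type*} [CommRing A] [CommRing B]

/-- Umbral evaluation: the linear functional on `A[X]` with moments `a`, sending `X ^ s` to
`a s`. -/
def umbral (a : ℕ → A) : A[X] →ₗ[A] A :=
  Polynomial.lsum fun s => LinearMap.toSpanSingleton A A (a s)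

lemma umbral_monomial (a : ℕ → A) (s : ℕ) (c : A) : umbral a (monomial s c) = c * a s := by
  simp [umbral, Polynomial.lsum_apply, Polynomial.sum_monomial_index]

@[simp]
lemma umbral_X_pow (a : ℕ → A) (s : ℕ) : umbral a (X ^ s) = a s := by
  rw [← monomial_one_right_eq_X_pow, umbral_monomial, one_mul]

@[simp]
lemma umbral_one (a : ℕ → A) : umbral a 1 = a 0 := by
  rw [← pow_zero X, umbral_X_pow]

@[simp]
lemma umbral_X (a : ℕ → A) : umbral a X = a 1 := by
  rw [← umbral_X_pow a, pow_one]

lemma umbral_C_mul (a : ℕ → A) (c : A) (q : A[X]) : umbral a (C c * q) = c * umbral a q := by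
  rw [← smul_eq_C_mul, map_smul, smul_eq_mul]

lemma umbral_map (f : A →+* B) (a : ℕ → A) (q : A[X]) :
    umbral (fun s => f (a s)) (q.map f) = f (umbral a q) := by
  induction q using Polynomial.induction_on' with
  | add q r hq hr => simp only [Polynomial.map_add, map_add, hq, hr]
  | monomial s c => simp only [map_monomial, umbral_monomial, map_mul]

lemma umbral_comp (a : ℕ → A) (v q : A[X]) :
    umbral a (q.comp v) = umbral (fun s => umbral a (v ^ s)) q := by
  induction q using Polynomial.induction_on' with
  | add q r hq hr => simp only [add_comp, map_add, hq, hr]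
  | monomial s c => rw [monomial_comp, umbral_C_mul, umbral_monomial]

lemma umbral_eq_zero_of_X_pow_dvd {a : ℕ → A} {N : ℕ} (ha : ∀ s, N ≤ s → a s = 0) {q : A[X]}
    (hq : X ^ N ∣ q) : umbral a q = 0 := by
  obtain ⟨q, rfl⟩ := hq
  induction q using Polynomial.induction_on' with
  | add q r hq hr => rw [mul_add, map_add, hq, hr, add_zero]
  | monomial s c =>
    rw [X_pow_mul_monomial, umbral_monomial, ha _ (Nat.le_add_left N s), mul_zero]

lemma umbral_X_pow_mul_add_pow (a : ℕ → A) (x l : A) (m s : ℕ) :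
    umbral a (X ^ m * (C x + C l * X) ^ s) =
      ∑ k ∈ Finset.range (s + 1), s.choose k * l ^ k * x ^ (s - k) * a (k + m) := by
  rw [add_comm, add_pow, Finset.mul_sum, map_sum]
  refine Finset.sum_congr rfl fun k _ => ?_
  rw [← umbral_X_pow a, ← umbral_C_mul]
  congr 1
  simp only [map_mul, map_pow, map_natCast]
  ring

lemma umbral_add_pow (a : ℕ → A) (x l : A) (s : ℕ) :
    umbral a ((C x + C l * X) ^ s) =
      ∑ k ∈ Finset.range (s + 1), s.choose k * l ^ k * x ^ (s - k) * a k := by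
  simpa using umbral_X_pow_mul_add_pow a x l 0 s

lemma umbral_X_pow_mul_one_add_pow (a : ℕ → A) (l : A) (m s : ℕ) :
    umbral a (X ^ m * (1 + C l * X) ^ s) =
      ∑ k ∈ Finset.range (s + 1), s.choose k * l ^ k * a (k + m) := by
  simpa using umbral_X_pow_mul_add_pow a 1 l m s

lemma umbral_one_add_pow (a : ℕ → A) (l : A) (s : ℕ) :
    umbral a ((1 + C l * X) ^ s) = ∑ k ∈ Finset.range (s + 1), s.choose k * l ^ k * a k := by
  simpa using umbral_X_pow_mul_one_add_pow a l 0 s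

/-- Umbral evaluation in two variables: in `A[X][X]` the inner variable is evaluated at the
moments `a` and the outer one at the moments `b`. -/
def umbral₂ (a b : ℕ → A) : A[X][X] →ₗ[A] A :=
  umbral a ∘ₗ (umbral fun s => C (b s)).restrictScalars A

lemma umbral₂_apply (a b : ℕ → A) (q : A[X][X]) :
    umbral₂ a b q = umbral a (umbral (fun s => C (b s)) q) := rfl

lemma umbral₂_C_mul_map (a b : ℕ → A) (p q : A[X]) :
    umbral₂ a b (C p * q.map C) = umbral a p * umbral b q := by
  rw [umbral₂_apply, umbral_C_mul, umbral_map, mul_comm, umbral_C_mul, mul_comm]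

lemma umbral₂_map (f : A →+* B) (a b : ℕ → A) (q : A[X][X]) :
    umbral₂ (fun s => f (a s)) (fun s => f (b s)) (q.map (mapRingHom f)) =
      f (umbral₂ a b q) := by
  have h := umbral_map (mapRingHom f) (fun s => C (b s)) q
  simp only [coe_mapRingHom, map_C] at h
  rw [umbral₂_apply, h, umbral_map, umbral₂_apply]

/-- The right translation `T ↦ T + t (1 + l T)` by a point `t`, for the group law
`T ↦ T ⊗ 1 + 1 ⊗ T + l T ⊗ T`. -/
def translationPoly (l t : A) : A[X] := X + C t * (1 + C l * X)

lemma umbral_translationPoly_pow (f : A →+* B) (a : ℕ → A) (l : A) (t : B) (s : ℕ) :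
    umbral (fun i => f (a i)) (translationPoly (f l) t ^ s) = ∑ i ∈ Finset.range (s + 1),
      s.choose i * (f (umbral a (X ^ (s - i) * (1 + C l * X) ^ i)) * t ^ i) := by
  rw [translationPoly, add_comm, add_pow, map_sum]
  refine Finset.sum_congr rfl fun i _ => ?_
  rw [← umbral_map, mul_comm (umbral _ _) (t ^ i), ← umbral_C_mul, ← umbral_C_mul]
  congr 1
  simp only [Polynomial.map_mul, Polynomial.map_pow, Polynomial.map_add, Polynomial.map_one,
    map_X, map_C, map_pow, map_natCast, mul_pow]
  ring

lemma umbral_translationPoly_one_add_pow (a : ℕ → A) (l t : A) (s : ℕ) :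
    umbral (fun i => umbral a (translationPoly l t ^ i)) ((1 + C l * X) ^ s) =
      (1 + l * t) ^ s * umbral a ((1 + C l * X) ^ s) := by
  rw [← umbral_comp, ← umbral_C_mul]
  congr 1
  simp only [translationPoly, pow_comp, add_comp, one_comp, mul_comp, C_comp, X_comp, map_pow,
    map_add, map_one, map_mul, ← mul_pow]
  ring

lemma umbral_translationPoly_pow_eq_zero {p n : ℕ} [Fact p.Prime] [Algebra (ZMod p) A] {a : ℕ → A}
    (ha : ∀ i, p ^ n ≤ i → a i = 0) (l : A) {t : A} (ht : t ^ p ^ n = 0) {s : ℕ}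
    (hs : p ^ n ≤ s) : umbral a (translationPoly l t ^ s) = 0 := by
  refine umbral_eq_zero_of_X_pow_dvd ha (Dvd.dvd.trans (dvd_of_eq ?_) (pow_dvd_pow _ hs))
  rw [translationPoly, add_pow_prime_pow_of_algebra, mul_pow, ← map_pow, ht, map_zero, zero_mul,
    add_zero]

end Umbral

section ConvQuotient

variable {A B : Type*} [CommRing A] [CommRing B]

/-- The homogenized group law `x T + (1 + l T) U` of `T ↦ T ⊗ 1 + 1 ⊗ T + l T ⊗ T`, with `U`
replaced by `U / x`; here `T` is the inner and `U` the outer variable of `A[X][X]`. -/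
def groupLaw (l x : A) : A[X][X] := C (C x * X) + C (1 + C l * X) * X

lemma groupLaw_pow (l x : A) (s : ℕ) :
    groupLaw l x ^ s = ∑ i ∈ Finset.range (s + 1),
      C (C (s.choose i * x ^ (s - i)) * (X ^ (s - i) * (1 + C l * X) ^ i)) * (X ^ i).map C := by
  rw [groupLaw, add_comm, add_pow]
  refine Finset.sum_congr rfl fun i _ => ?_
  simp only [map_mul, map_pow, map_natCast, mul_pow, Polynomial.map_pow, map_X]
  ring

lemma umbral₂_groupLaw_pow (l x : A) (a b : ℕ → A) (s : ℕ) :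
    umbral₂ a b (groupLaw l x ^ s) = ∑ i ∈ Finset.range (s + 1),
      s.choose i * x ^ (s - i) * umbral a (X ^ (s - i) * (1 + C l * X) ^ i) * b i := by
  simp only [groupLaw_pow, map_sum, umbral₂_C_mul_map, umbral_C_mul, umbral_X_pow]

/-- The moments `b` are the quotient of the moments `s ↦ a 0 ^ (1 - s) * a 1 ^ s` of a character
by the moments `a`, for the convolution product dual to `T ↦ T ⊗ 1 + 1 ⊗ T + l T ⊗ T`; powers of
`a 0` are distributed so as to avoid denominators. -/
def IsConvQuotient (l : A) (a b : ℕ → A) : Prop :=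
  ∀ s, umbral₂ a b (groupLaw l (a 0) ^ s) = a 0 * a 1 ^ s

namespace IsConvQuotient

variable {l : A} {a b : ℕ → A}

lemma umbral₂_aeval (h : IsConvQuotient l a b) (q : A[X]) :
    umbral₂ a b (aeval (groupLaw l (a 0)) q) = a 0 * q.eval (a 1) := by
  induction q using Polynomial.induction_on' with
  | add q r hq hr => rw [map_add, map_add, hq, hr, eval_add, mul_add]
  | monomial s c =>
    rw [aeval_monomial, ← Algebra.smul_def, map_smul, h, eval_monomial, smul_eq_mul]
    ring

lemma map (h : IsConvQuotient l a b) (f : A →+* B) :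
    IsConvQuotient (f l) (fun s => f (a s)) fun s => f (b s) := by
  intro s
  have hW : groupLaw (f l) (f (a 0)) = (groupLaw l (a 0)).map (mapRingHom f) := by
    simp [groupLaw]
  rw [hW, ← Polynomial.map_pow, umbral₂_map, h s, map_mul, map_pow]

lemma translate (h : IsConvQuotient l a b) (t : A) :
    IsConvQuotient l (fun s => umbral a (translationPoly l t ^ s)) b := by
  intro s
  set v := translationPoly l t with hv
  have hmap : (groupLaw l (a 0) ^ s).map (compRingHom v) =
      aeval (groupLaw l (a 0)) ((C (1 + l * t) * X + C (t * a 0)) ^ s) := by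
    simp only [groupLaw, hv, translationPoly, Polynomial.map_pow, Polynomial.map_add,
      Polynomial.map_mul, Polynomial.map_one, map_C, map_X, coe_compRingHom_apply, C_comp, X_comp,
      map_add, map_mul, map_pow, map_one, aeval_X, aeval_C, Polynomial.algebraMap_apply,
      algebraMap_eq]
    ring
  have hcomp (q : A[X][X]) :
      umbral₂ (fun s => umbral a (v ^ s)) b q = umbral₂ a b (q.map (compRingHom v)) := by
    have h := umbral_map (compRingHom v) (fun s => C (b s)) q
    simp only [coe_compRingHom_apply, C_comp] at h
    rw [umbral₂_apply, umbral₂_apply, h, umbral_comp]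
  have hv1 : umbral a v = a 1 + t * (a 0 + l * a 1) := by
    simp only [hv, translationPoly, map_add, umbral_C_mul, umbral_one, umbral_X]
  simp only [pow_zero, pow_one, umbral_one]
  rw [hcomp, hmap, h.umbral₂_aeval, hv1]
  simp only [eval_pow, eval_add, eval_mul, eval_C, eval_X]
  ring

/-- Since `x + l (x T + (1 + l T) U) = (1 + l T) (x + l U)`, the powers of `1 + l T` are grouplike
and the convolution becomes a product on them. -/
lemma umbral_mul_umbral (h : IsConvQuotient l a b) (s : ℕ) :
    umbral a ((1 + C l * X) ^ s) * umbral b ((C (a 0) + C l * X) ^ s) =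
      a 0 * (a 0 + l * a 1) ^ s := by
  have hW : C ((1 + C l * X) ^ s) * ((C (a 0) + C l * X) ^ s).map C =
      aeval (groupLaw l (a 0)) ((C (a 0) + C l * X) ^ s) := by
    simp only [groupLaw, Polynomial.map_pow, Polynomial.map_add, Polynomial.map_mul, map_C, map_X,
      map_add, map_mul, map_pow, map_one, aeval_X, aeval_C, Polynomial.algebraMap_apply,
      algebraMap_eq, ← mul_pow]
    ring
  rw [← umbral₂_C_mul_map, hW, h.umbral₂_aeval]
  simp only [eval_pow, eval_add, eval_mul, eval_C, eval_X]

lemma sum_range_add (h : IsConvQuotient l a b) (s : ℕ) :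
    ∑ i ∈ Finset.range s, s.choose i * a 0 ^ (s - i) *
        umbral a (X ^ (s - i) * (1 + C l * X) ^ i) * b i + umbral a ((1 + C l * X) ^ s) * b s =
      a 0 * a 1 ^ s := by
  rw [← h s, umbral₂_groupLaw_pow, Finset.sum_range_succ]
  simp

lemma unique (h : IsConvQuotient l a b) (hu : ∀ s, IsUnit (umbral a ((1 + C l * X) ^ s)))
    {b' : ℕ → A} (h' : IsConvQuotient l a b') (s : ℕ) : b s = b' s := by
  induction s using Nat.strong_induction_on with | _ s ih
  refine (hu s).mul_left_cancel (add_left_cancel ((h.sum_range_add s).trans ?_))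
  rw [← h'.sum_range_add s]
  congr 1
  exact Finset.sum_congr rfl fun i hi => by rw [ih i (Finset.mem_range.1 hi)]

lemma apply_zero (h : IsConvQuotient l a b) (hu : IsUnit (a 0)) : b 0 = 1 :=
  hu.mul_left_cancel (by simpa using h.sum_range_add 0)

lemma apply_one (h : IsConvQuotient l a b) (hu : IsUnit (a 0)) (hu' : IsUnit (a 0 + l * a 1)) :
    b 1 = 0 :=
  hu'.mul_left_cancel (by simpa [h.apply_zero hu, umbral_C_mul] using h.sum_range_add 1)

lemma pow_mul_eq (h : IsConvQuotient l a b) (hu : ∀ s, IsUnit (umbral a ((1 + C l * X) ^ s)))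
    {s : ℕ} (hs : 2 ≤ s) :
    l ^ s * b s = (a 0 + l * a 1) ^ s * a 0 * Ring.inverse (umbral a ((1 + C l * X) ^ s)) -
      a 0 ^ s - ∑ k ∈ Finset.Ico 2 s, s.choose k * l ^ k * a 0 ^ (s - k) * b k := by
  have h0 : IsUnit (a 0) := by simpa using hu 0
  have h1 : IsUnit (a 0 + l * a 1) := by simpa [umbral_C_mul] using hu 1
  have hB : umbral b ((C (a 0) + C l * X) ^ s) =
      (a 0 + l * a 1) ^ s * a 0 * Ring.inverse (umbral a ((1 + C l * X) ^ s)) := by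
    rw [Ring.eq_mul_inverse_iff_mul_eq _ _ _ (hu s), mul_comm, h.umbral_mul_umbral, mul_comm]
  rw [← hB, umbral_add_pow, Finset.sum_range_succ, Finset.range_eq_Ico,
    Finset.sum_eq_sum_Ico_succ_bot (by omega), Finset.sum_eq_sum_Ico_succ_bot (by omega),
    h.apply_zero h0, h.apply_one h0 h1]
  simp only [Nat.choose_zero_right, Nat.choose_self, Nat.cast_one, pow_zero, Nat.sub_zero,
    Nat.sub_self, mul_one, one_mul, mul_zero, zero_add]
  ring

/-- In the convolution identity for `a 0 * a 1 ^ s`, the terms containing `a s` add up to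
`a s * umbral b ((a 0 + l X) ^ s)`. -/
lemma mul_umbral_mem (h : IsConvQuotient l a b) (E : Subring A) (hl : l ∈ E) {s : ℕ}
    (ha0 : a 0 ∈ E) (ha1 : a 1 ∈ E) (ha : ∀ j < s, a j ∈ E) (hb : ∀ i ≤ s, b i ∈ E) :
    a s * umbral b ((C (a 0) + C l * X) ^ s) ∈ E := by
  have hsplit (i : ℕ) (hi : i ∈ Finset.range (s + 1)) :
      s.choose i * a 0 ^ (s - i) * umbral a (X ^ (s - i) * (1 + C l * X) ^ i) * b i =
        a s * (s.choose i * l ^ i * a 0 ^ (s - i) * b i) + s.choose i * a 0 ^ (s - i) *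
          (∑ k ∈ Finset.range i, i.choose k * l ^ k * a (k + (s - i))) * b i := by
    rw [umbral_X_pow_mul_one_add_pow, Finset.sum_range_succ,
      Nat.add_sub_of_le (Finset.mem_range_succ_iff.1 hi), Nat.choose_self]
    ring
  have heq := (umbral₂_groupLaw_pow l (a 0) a b s).symm.trans (h s)
  rw [Finset.sum_congr rfl hsplit, Finset.sum_add_distrib, ← Finset.mul_sum,
    ← umbral_add_pow] at heq
  rw [eq_sub_of_add_eq heq]
  refine sub_mem (mul_mem ha0 (pow_mem ha1 s)) (sum_mem fun i hi => ?_)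
  have hi := Finset.mem_range_succ_iff.1 hi
  refine mul_mem (mul_mem (mul_mem (natCast_mem E _) (pow_mem ha0 _)) (sum_mem fun k hk => ?_))
    (hb i hi)
  have hk := Finset.mem_range.1 hk
  exact mul_mem (mul_mem (natCast_mem E _) (pow_mem hl k)) (ha _ (by omega))

end IsConvQuotient

/-- The moments `b` with `IsConvQuotient l a b`, by recursion; they exist as soon as the moments
`a` take unit values on the powers of `1 + l X`. -/
def convQuotient (l : A) (a : ℕ → A) (s : ℕ) : A :=
  Ring.inverse (umbral a ((1 + C l * X) ^ s)) * (a 0 * a 1 ^ s - ∑ i : Fin s,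
    s.choose i * a 0 ^ (s - i : ℕ) * umbral a (X ^ (s - i : ℕ) * (1 + C l * X) ^ (i : ℕ)) *
      convQuotient l a i)
  termination_by s
  decreasing_by exact i.2

lemma isConvQuotient_convQuotient {l : A} {a : ℕ → A}
    (hu : ∀ s, IsUnit (umbral a ((1 + C l * X) ^ s))) :
    IsConvQuotient l a (convQuotient l a) := by
  intro s
  rw [umbral₂_groupLaw_pow, Finset.sum_range_succ, convQuotient, Finset.sum_range, Nat.choose_self,
    Nat.sub_self, pow_zero, pow_zero, Nat.cast_one, one_mul, one_mul, one_mul,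
    Ring.mul_inverse_cancel_left _ _ (hu s), add_sub_cancel]

end ConvQuotient

end

namespace UnitGroupScheme

noncomputable section

open Polynomial (C)

section Ring

variable {R : Type*} [CommRing R] (lam : R) (N : ℕ)

lemma X_of_le {s : ℕ} (hs : N ≤ s) : X lam N s = 0 := by
  rw [X, polyX, dif_neg hs.not_gt, map_zero]

lemma Y_eq_umbral (s : ℕ) : Y lam N s =
    umbral (X lam N) ((1 + C (algebraMap R (SA lam N) lam) * Polynomial.X) ^ s) := by
  simp only [umbral_one_add_pow, Y, map_pow]

variable {lam N} in
lemma map_Y {B : Type*} [CommRing B] (f : SA lam N →+* B) (s : ℕ) : f (Y lam N s) =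
    umbral (fun i => f (X lam N i)) ((1 + C (f (algebraMap R _ lam)) * Polynomial.X) ^ s) := by
  rw [Y_eq_umbral, ← umbral_map]
  simp only [Polynomial.map_pow, Polynomial.map_add, Polynomial.map_mul, Polynomial.map_one,
    Polynomial.map_C, Polynomial.map_X]

lemma Y_zero : Y lam N 0 = X lam N 0 := by
  rw [Y_eq_umbral, pow_zero, umbral_one]

lemma Y_one : Y lam N 1 = X lam N 0 + algebraMap R (SA lam N) lam * X lam N 1 := by
  rw [Y_eq_umbral, pow_one, map_add, umbral_one, umbral_C_mul, umbral_X]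

/-- A form of `P lam N` whose recursion divides by `Y lam N s` only, not by powers of `lam`; it
takes the values `1` and `0` at `s = 0` and `s = 1`. -/
def convP : ℕ → SA lam N := convQuotient (algebraMap R (SA lam N) lam) (X lam N)

variable {lam N} in
lemma isConvQuotient_convP (hu : ∀ s, IsUnit (Y lam N s)) :
    IsConvQuotient (algebraMap R (SA lam N) lam) (X lam N) (convP lam N) :=
  isConvQuotient_convQuotient fun s => Y_eq_umbral lam N s ▸ hu s

variable {lam N} in
lemma pow_mul_convP (hu : ∀ s, IsUnit (Y lam N s)) {s : ℕ} (hs : 2 ≤ s) :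
    algebraMap R (SA lam N) lam ^ s * convP lam N s =
      (X lam N 0 + algebraMap R (SA lam N) lam * X lam N 1) ^ s * X lam N 0 *
          Ring.inverse (Y lam N s) - X lam N 0 ^ s -
        ∑ k ∈ Finset.Ico 2 s, (s.choose k : SA lam N) * algebraMap R (SA lam N) lam ^ k *
          X lam N 0 ^ (s - k) * convP lam N k := by
  rw [Y_eq_umbral]
  exact (isConvQuotient_convP hu).pow_mul_eq (fun s => Y_eq_umbral lam N s ▸ hu s) hs

end Ring

section BaseChange

variable {R R' : Type*} [CommRing R] [CommRing R'] (f : R →+* R') {lam : R} {lam' : R'} (N : ℕ)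
  (h : f lam = lam')

lemma baseChange_algebraMap_mvPolynomial (q : MvPolynomial (Fin N) R) :
    baseChange f N h (algebraMap _ (SA lam N) q) =
      algebraMap _ (SA lam' N) (MvPolynomial.map f q) :=
  IsLocalization.Away.lift_eq _ _ _

lemma baseChange_algebraMap (r : R) :
    baseChange f N h (algebraMap R (SA lam N) r) = algebraMap R' (SA lam' N) (f r) := by
  rw [IsScalarTower.algebraMap_apply R (MvPolynomial (Fin N) R) (SA lam N),
    baseChange_algebraMap_mvPolynomial, MvPolynomial.algebraMap_eq, MvPolynomial.map_C,
    ← MvPolynomial.algebraMap_eq, ← IsScalarTower.algebraMap_apply]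

lemma baseChange_X (s : ℕ) : baseChange f N h (X lam N s) = X lam' N s := by
  rw [X, baseChange_algebraMap_mvPolynomial, map_polyX, X]

lemma baseChange_injective (hf : Function.Injective f) : Function.Injective (baseChange f N h) := by
  refine (IsLocalization.lift_injective_iff (M := Submonoid.powers (disc lam N)) _).2 fun x y => ?_
  rw [RingHom.comp_apply, RingHom.comp_apply,
    IsLocalization.eq_iff_exists (Submonoid.powers (disc lam N)),
    IsLocalization.eq_iff_exists (Submonoid.powers (disc lam' N))]
  have hmem (m : ℕ) : disc lam' N ^ m = MvPolynomial.map f (disc lam N ^ m) := by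
    rw [map_pow, map_disc f N h]
  constructor
  · rintro ⟨⟨_, m, rfl⟩, hm⟩
    refine ⟨⟨_, m, rfl⟩, ?_⟩
    simp only [hmem, ← map_mul]
    exact congrArg _ hm
  · rintro ⟨⟨_, m, rfl⟩, hm⟩
    refine ⟨⟨_, m, rfl⟩, MvPolynomial.map_injective f hf ?_⟩
    simpa only [hmem, ← map_mul] using hm

include h in
lemma baseChange_convP (hu : ∀ s, IsUnit (Y lam N s)) (hu' : ∀ s, IsUnit (Y lam' N s)) (s : ℕ) :
    baseChange f N h (convP lam N s) = convP lam' N s := by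
  have hP := (isConvQuotient_convP hu).map (baseChange f N h)
  simp only [baseChange_algebraMap, baseChange_X, h] at hP
  exact hP.unique (fun s => Y_eq_umbral lam' N s ▸ hu' s) (isConvQuotient_convP hu') s

lemma toSALaurent_injective (R : Type*) [CommRing R] (N : ℕ) :
    Function.Injective (toSALaurent R N) :=
  baseChange_injective _ _ _ Polynomial.toLaurent_injective

end BaseChange

section Char

variable {p n : ℕ} [Fact p.Prime] {R : Type*} [CommRing R] [Algebra (ZMod p) R] (lam : R)

lemma Y_add_self (s : ℕ) : Y lam (p ^ n) (s + p ^ n) = Y lam (p ^ n) s := by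
  rw [Y_eq_umbral, Y_eq_umbral, pow_add, add_pow_prime_pow_of_algebra, one_pow, mul_add, mul_one,
    map_add, add_eq_left]
  refine umbral_eq_zero_of_X_pow_dvd (fun s hs => X_of_le lam (p ^ n) hs) ?_
  rw [mul_pow]
  exact (dvd_mul_left _ _).mul_left _

lemma isUnit_Y_of_char (s : ℕ) : IsUnit (Y lam (p ^ n) s) := by
  have hper : Function.Periodic (Y lam (p ^ n)) (p ^ n) := Y_add_self lam
  rw [← hper.map_mod_nat]
  exact isUnit_Y lam _ (Nat.mod_lt _ (pow_pos (Fact.out : p.Prime).pos n))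

lemma isUnit_X_zero : IsUnit (X lam (p ^ n) 0) :=
  Y_zero lam (p ^ n) ▸ isUnit_Y_of_char lam 0

lemma Y_one_pow : Y lam (p ^ n) 1 ^ p ^ n = X lam (p ^ n) 0 ^ p ^ n +
    algebraMap R (SA lam (p ^ n)) (lam ^ p ^ n) * X lam (p ^ n) 1 ^ p ^ n := by
  rw [Y_one, add_pow_prime_pow_of_algebra, mul_pow, map_pow]

lemma laurentP_eq_convP {s : ℕ} (hs : 2 ≤ s) :
    laurentP R (p ^ n) s = convP (LaurentPolynomial.T 1) (p ^ n) s := by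
  induction s using Nat.strong_induction_on with | _ s ih
  have hT (k : ℕ) :
      algebraMap (LaurentPolynomial R) (SALaurent R (p ^ n)) (LaurentPolynomial.T k) =
        algebraMap (LaurentPolynomial R) _ (LaurentPolynomial.T 1) ^ k := by
    rw [← map_pow, LaurentPolynomial.T_pow, mul_one]
  have hP := pow_mul_convP
    (isUnit_Y_of_char (p := p) (n := n) (LaurentPolynomial.T 1 : LaurentPolynomial R)) hs
  rw [← Finset.sum_attach (Finset.Ico 2 s)] at hP
  have hk (k : Finset.Ico 2 s) : laurentP R (p ^ n) k = convP (LaurentPolynomial.T 1) (p ^ n) k :=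
    ih k (Finset.mem_Ico.1 k.2).2 (Finset.mem_Ico.1 k.2).1
  rw [laurentP]
  simp only [hk, hT]
  rw [← hP, ← mul_assoc, ← hT, ← map_mul, ← LaurentPolynomial.T_add, neg_add_cancel,
    LaurentPolynomial.T_zero, map_one, one_mul]

variable (R) in
lemma toSALaurent_convP {s : ℕ} (hs : 2 ≤ s) :
    toSALaurent R (p ^ n) (convP Polynomial.X (p ^ n) s) = laurentP R (p ^ n) s := by
  rw [laurentP_eq_convP hs, toSALaurent, baseChange_convP]
  exacts [isUnit_Y_of_char _, isUnit_Y_of_char _]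

lemma P_eq_convP {s : ℕ} (hs : 2 ≤ s) : P lam (p ^ n) s = convP lam (p ^ n) s := by
  have hex : ∃ q : SAPoly R (p ^ n), toSALaurent R (p ^ n) q = laurentP R (p ^ n) s :=
    ⟨_, toSALaurent_convP R hs⟩
  have hq : hex.choose = convP Polynomial.X (p ^ n) s :=
    toSALaurent_injective R _ (hex.choose_spec.trans (toSALaurent_convP R hs).symm)
  rw [P, dif_pos hex, hq]
  exact baseChange_convP _ _ _ (isUnit_Y_of_char _) (isUnit_Y_of_char _) s

end Char

section Trunc

variable {R A : Type*} [CommRing R] [CommRing A] [Algebra R A] {N : ℕ}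

variable (R N) in
lemma truncT_pow_self : truncT R N ^ N = 0 := by
  rw [truncT, ← map_pow, Ideal.Quotient.eq_zero_iff_mem]
  exact Ideal.subset_span rfl

/-- The algebra map on `R[T]/(T^N)` with `T ↦ t`, for `t` with `t ^ N = 0`. -/
def truncLift (t : A) (ht : t ^ N = 0) : TruncPoly R N →ₐ[R] A :=
  Ideal.Quotient.liftₐ _ (Polynomial.aeval t) fun q hq => by
    obtain ⟨r, rfl⟩ := Ideal.mem_span_singleton.1 hq
    rw [map_mul, Polynomial.aeval_X_pow, ht, zero_mul]

lemma truncLift_truncT (t : A) (ht : t ^ N = 0) :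
    truncLift t ht (truncT R N) = t :=
  Polynomial.aeval_X t

variable (R A N) in
/-- The natural map `A ⊗ R[T]/(T^N) → A[T]/(T^N)`. -/
def tensorTrunc : A ⊗[R] TruncPoly R N →ₐ[A] TruncPoly A N :=
  Algebra.TensorProduct.lift (Algebra.ofId A _) (truncLift (truncT A N) (truncT_pow_self A N))
    fun _ _ => Commute.all _ _

lemma tensorTrunc_tmul (a : A) (x : TruncPoly R N) : tensorTrunc R A N (a ⊗ₜ x) =
    algebraMap A _ a * truncLift (truncT A N) (truncT_pow_self A N) x := rfl

variable (R A N) in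
lemma tensorTrunc_injective : Function.Injective (tensorTrunc R A N) := by
  let t : A ⊗[R] TruncPoly R N := 1 ⊗ₜ truncT R N
  have ht : t ^ N = 0 := by
    rw [Algebra.TensorProduct.tmul_pow, truncT_pow_self, TensorProduct.tmul_zero]
  let g : TruncPoly A N →ₐ[A] A ⊗[R] TruncPoly R N := truncLift t ht
  have h : g.comp (tensorTrunc R A N) = AlgHom.id A _ := by
    refine Algebra.TensorProduct.ext_ring (Ideal.Quotient.algHom_ext R (Polynomial.algHom_ext ?_))
    change g (tensorTrunc R A N (1 ⊗ₜ truncT R N)) = t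
    rw [tensorTrunc_tmul, truncLift_truncT, map_one, one_mul]
    exact truncLift_truncT t ht
  exact Function.LeftInverse.injective (AlgHom.congr_fun h)

lemma eq_zero_of_aeval_truncT {q : Polynomial A} (hdeg : q.natDegree < N)
    (hq : Polynomial.aeval (truncT A N) q = 0) : q = 0 := by
  have hmk : Ideal.Quotient.mkₐ A (Ideal.span {(Polynomial.X ^ N : Polynomial A)}) q = 0 := by
    rw [← hq, ← Polynomial.aeval_X_left_apply q, ← Polynomial.aeval_algHom_apply,
      Polynomial.aeval_X_left_apply]
    rfl
  rw [Ideal.Quotient.mkₐ_eq_mk, Ideal.Quotient.eq_zero_iff_dvd] at hmk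
  ext d
  rcases lt_or_ge d N with hd | hd
  · exact Polynomial.X_pow_dvd_iff.1 hmk d hd
  · exact Polynomial.coeff_eq_zero_of_natDegree_lt (hdeg.trans_le hd)

end Trunc

section Coaction

variable {R : Type*} [CommRing R] (lam : R) (N : ℕ)

/-- The coaction with values in `S(A_R^{(λ)})_Θ[T]/(T^N)`, which is isomorphic to the tensor
product `S(A_R^{(λ)})_Θ ⊗ R[T]/(T^N)`. -/
def truncCoaction : SA lam N →ₐ[R] TruncPoly (SA lam N) N :=
  ((tensorTrunc R (SA lam N) N).restrictScalars R).comp (coaction lam N)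

variable {lam N} in
lemma mem_coinvariants_iff {a : SA lam N} : a ∈ coinvariants lam N ↔
    truncCoaction lam N a = algebraMap (SA lam N) (TruncPoly (SA lam N) N) a := by
  have h : tensorTrunc R (SA lam N) N (a ⊗ₜ 1) = algebraMap (SA lam N) _ a := by
    rw [tensorTrunc_tmul, map_one, mul_one]
  rw [coinvariants, AlgHom.mem_equalizer, ← h]
  exact (tensorTrunc_injective R (SA lam N) N).eq_iff.symm

variable {lam N} in
lemma inverse_mem_coinvariants {a : SA lam N} (ha : IsUnit a) (h : a ∈ coinvariants lam N) :
    Ring.inverse a ∈ coinvariants lam N := by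
  rw [mem_coinvariants_iff] at h ⊢
  rw [map_ringInverse (truncCoaction lam N) ha, h]
  exact (map_ringInverse (algebraMap _ _) ha).symm

lemma comul_X {s : ℕ} (hs : s < N) : comul lam N (X lam N s) = comulX lam N s := by
  rw [X, ← comulPoly_polyX lam N hs]
  exact IsLocalization.lift_eq _ _

lemma immersion_X (s : ℕ) : immersion lam N (X lam N s) = truncT R N ^ s := by
  rcases lt_or_ge s N with hs | hs
  · rw [X, immersion]
    refine (IsLocalization.lift_eq _ _).trans ?_
    simp [immersionPoly, polyX, hs]
  · rw [X_of_le lam N hs, map_zero, pow_eq_zero_of_le hs (truncT_pow_self R N)]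

lemma truncCoaction_X_of_lt {s : ℕ} (hs : s < N) : truncCoaction lam N (X lam N s) =
    umbral (fun i => algebraMap (SA lam N) (TruncPoly (SA lam N) N) (X lam N i))
      (translationPoly (algebraMap (SA lam N) _ (algebraMap R _ lam))
        (truncT (SA lam N) N) ^ s) := by
  rw [truncCoaction, AlgHom.comp_apply, coaction, AlgHom.comp_apply, comul_X lam N hs, comulX,
    umbral_translationPoly_pow, map_sum, map_sum]
  refine Finset.sum_congr rfl fun i _ => ?_
  rw [map_mul, map_natCast, map_mul, map_natCast, Algebra.TensorProduct.map_tmul, immersion_X,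
    AlgHom.restrictScalars_apply, tensorTrunc_tmul, map_pow, truncLift_truncT, AlgHom.id_apply,
    umbral_X_pow_mul_one_add_pow]
  simp only [map_pow]

end Coaction

section CoactionChar

variable {p n : ℕ} [Fact p.Prime] {R : Type*} [CommRing R] [Algebra (ZMod p) R] (lam : R)

lemma truncCoaction_X (s : ℕ) : truncCoaction lam (p ^ n) (X lam (p ^ n) s) =
    umbral (fun i => algebraMap (SA lam (p ^ n)) (TruncPoly (SA lam (p ^ n)) (p ^ n))
      (X lam (p ^ n) i)) (translationPoly (algebraMap (SA lam (p ^ n)) _ (algebraMap R _ lam))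
        (truncT (SA lam (p ^ n)) (p ^ n)) ^ s) := by
  rcases lt_or_ge s (p ^ n) with hs | hs
  · exact truncCoaction_X_of_lt _ _ hs
  · rw [X_of_le _ _ hs, map_zero, umbral_translationPoly_pow_eq_zero (fun i hi => ?_) _
      (truncT_pow_self _ _) hs]
    rw [X_of_le _ _ hi, map_zero]

lemma truncCoaction_X_zero : truncCoaction lam (p ^ n) (X lam (p ^ n) 0) =
    algebraMap _ _ (X lam (p ^ n) 0) := by
  rw [truncCoaction_X, pow_zero, umbral_one]

lemma truncCoaction_X_one : truncCoaction lam (p ^ n) (X lam (p ^ n) 1) =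
    algebraMap _ _ (X lam (p ^ n) 1) +
      algebraMap _ _ (Y lam (p ^ n) 1) * truncT (SA lam (p ^ n)) (p ^ n) := by
  rw [truncCoaction_X, pow_one, translationPoly, map_add, umbral_X, umbral_C_mul, map_add,
    umbral_one, umbral_C_mul, umbral_X, Y_one, map_add, map_mul, mul_comm (truncT _ _)]

lemma truncCoaction_algebraMap (N : ℕ) (r : R) : truncCoaction lam N (algebraMap R _ r) =
    algebraMap (SA lam N) (TruncPoly (SA lam N) N) (algebraMap R _ r) := by
  rw [AlgHom.commutes, ← IsScalarTower.algebraMap_apply]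

lemma truncCoaction_Y (s : ℕ) : truncCoaction lam (p ^ n) (Y lam (p ^ n) s) =
    (1 + algebraMap (SA lam (p ^ n)) (TruncPoly (SA lam (p ^ n)) (p ^ n)) (algebraMap R _ lam) *
      truncT (SA lam (p ^ n)) (p ^ n)) ^ s * algebraMap _ _ (Y lam (p ^ n) s) := by
  rw [map_Y (algebraMap _ _), ← umbral_translationPoly_one_add_pow]
  simpa only [AlgHom.toRingHom_eq_coe, RingHom.coe_coe, truncCoaction_X,
    truncCoaction_algebraMap] using map_Y (truncCoaction lam (p ^ n)).toRingHom s

lemma truncCoaction_convP (s : ℕ) : truncCoaction lam (p ^ n) (convP lam (p ^ n) s) =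
    algebraMap _ _ (convP lam (p ^ n) s) := by
  have hP := isConvQuotient_convP (isUnit_Y_of_char (p := p) (n := n) lam)
  have hρ := hP.map (truncCoaction lam (p ^ n)).toRingHom
  have hι := (hP.map (algebraMap _ (TruncPoly (SA lam (p ^ n)) (p ^ n)))).translate (truncT _ _)
  simp only [AlgHom.toRingHom_eq_coe, RingHom.coe_coe, truncCoaction_X,
    truncCoaction_algebraMap] at hρ
  refine hρ.unique (fun s => ?_) hι s
  rw [umbral_translationPoly_one_add_pow, ← map_Y, ← truncCoaction_Y]
  exact (isUnit_Y_of_char lam s).map _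

lemma X_zero_mem_coinvariants : X lam (p ^ n) 0 ∈ coinvariants lam (p ^ n) :=
  mem_coinvariants_iff.2 (truncCoaction_X_zero lam)

lemma X_one_pow_mem_coinvariants : X lam (p ^ n) 1 ^ p ^ n ∈ coinvariants lam (p ^ n) := by
  rw [mem_coinvariants_iff, map_pow, truncCoaction_X_one, add_pow_prime_pow_of_algebra, mul_pow,
    truncT_pow_self, mul_zero, add_zero, map_pow]

lemma Y_mul_inverse_mem_coinvariants (s : ℕ) :
    Y lam (p ^ n) s * Ring.inverse (Y lam (p ^ n) 1 ^ s) ∈ coinvariants lam (p ^ n) := by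
  refine mem_coinvariants_iff.2 (map_mul_ringInverse_eq (truncCoaction lam (p ^ n))
    (algebraMap _ (TruncPoly (SA lam (p ^ n)) (p ^ n))) ((isUnit_Y_of_char lam 1).pow s)
    (truncCoaction_Y lam s) ?_)
  rw [map_pow, truncCoaction_Y, pow_one, mul_pow, map_pow]

lemma generated_le_coinvariants : generated lam (p ^ n) ≤ coinvariants lam (p ^ n) := by
  have hX0 := X_zero_mem_coinvariants (p := p) (n := n) lam
  have hX1 := X_one_pow_mem_coinvariants (p := p) (n := n) lam
  refine Algebra.adjoin_le ?_
  rintro x (((rfl | rfl | rfl | rfl) | ⟨s, hs, -, rfl⟩) | ⟨s, -, -, rfl⟩)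
  · exact hX0
  · exact inverse_mem_coinvariants (isUnit_X_zero lam) hX0
  · exact hX1
  · refine inverse_mem_coinvariants ?_
      (add_mem (pow_mem hX0 _) (mul_mem (Subalgebra.algebraMap_mem _ _) hX1))
    exact Y_one_pow (p := p) (n := n) lam ▸ (isUnit_Y_of_char lam 1).pow _
  · rw [P_eq_convP lam hs]
    exact mem_coinvariants_iff.2 (truncCoaction_convP lam s)
  · rw [← Y_one]
    exact Y_mul_inverse_mem_coinvariants lam s

end CoactionChar

section Generation

variable {R : Type*} [CommRing R] {lam : R} {N : ℕ} {E : Subalgebra R (SA lam N)}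

lemma algebraMap_mvPolynomial_mem (hX : ∀ s < N, X lam N s ∈ E) (q : MvPolynomial (Fin N) R) :
    algebraMap _ (SA lam N) q ∈ E := by
  induction q using MvPolynomial.induction_on with
  | C r =>
    rw [← MvPolynomial.algebraMap_eq, ← IsScalarTower.algebraMap_apply]
    exact Subalgebra.algebraMap_mem _ _
  | add a b ha hb =>
    rw [map_add]
    exact add_mem ha hb
  | mul_X a i ha =>
    rw [map_mul]
    exact mul_mem ha (by simpa [X, polyX] using hX i i.2)

lemma eq_top_of_X_mem_of_inverse_Y_mem (hX : ∀ s < N, X lam N s ∈ E)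
    (hY : ∀ s < N, Ring.inverse (Y lam N s) ∈ E) : E = ⊤ := by
  refine eq_top_iff.2 fun a _ => ?_
  have hd : algebraMap _ (SA lam N) (disc lam N) * ∏ s ∈ Finset.range N,
      Ring.inverse (Y lam N s) = 1 := by
    refine (congrArg (algebraMap _ (SA lam N) · * _) (disc_eq lam N)).trans ?_
    rw [map_prod, ← Finset.prod_mul_distrib]
    refine Finset.prod_eq_one fun s hs => ?_
    rw [algebraMap_polyY, Ring.mul_inverse_cancel _ (isUnit_Y lam N (Finset.mem_range.1 hs))]
  obtain ⟨m, q, hq⟩ := IsLocalization.Away.surj (disc lam N) a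
  have ha : a = algebraMap _ _ q * (∏ s ∈ Finset.range N, Ring.inverse (Y lam N s)) ^ m := by
    rw [← hq, mul_assoc, ← mul_pow, hd, one_pow, mul_one]
  rw [ha]
  exact mul_mem (algebraMap_mvPolynomial_mem hX q)
    (pow_mem (prod_mem fun s hs => hY s (Finset.mem_range.1 hs)) m)

lemma X_zero_mem_generated : X lam N 0 ∈ generated lam N :=
  Algebra.subset_adjoin (.inl (.inl (.inl rfl)))

lemma inverse_X_zero_mem_generated : Ring.inverse (X lam N 0) ∈ generated lam N :=
  Algebra.subset_adjoin (.inl (.inl (.inr (.inl rfl))))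

lemma X_one_pow_mem_generated : X lam N 1 ^ N ∈ generated lam N :=
  Algebra.subset_adjoin (.inl (.inl (.inr (.inr (.inl rfl)))))

lemma Y_mul_inverse_mem_generated {s : ℕ} (h2 : 2 ≤ s) (hs : s < N) :
    Y lam N s * Ring.inverse (Y lam N 1 ^ s) ∈ generated lam N := by
  rw [Y_one]
  exact Algebra.subset_adjoin (.inr ⟨s, h2, hs, rfl⟩)

lemma Y_one_mem (hE : generated lam N ≤ E) (h1 : X lam N 1 ∈ E) : Y lam N 1 ∈ E := by
  rw [Y_one]
  exact add_mem (hE X_zero_mem_generated) (mul_mem (Subalgebra.algebraMap_mem _ _) h1)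

end Generation

section GenerationChar

variable {p n : ℕ} [Fact p.Prime] {R : Type*} [CommRing R] [Algebra (ZMod p) R] {lam : R}
  {E : Subalgebra R (SA lam (p ^ n))}

lemma convP_zero : convP lam (p ^ n) 0 = 1 :=
  (isConvQuotient_convP (isUnit_Y_of_char lam)).apply_zero (isUnit_X_zero lam)

lemma convP_one : convP lam (p ^ n) 1 = 0 :=
  (isConvQuotient_convP (isUnit_Y_of_char lam)).apply_one (isUnit_X_zero lam)
    (Y_one lam (p ^ n) ▸ isUnit_Y_of_char lam 1)

lemma inverse_Y_one_pow_mem_generated :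
    Ring.inverse (Y lam (p ^ n) 1 ^ p ^ n) ∈ generated lam (p ^ n) := by
  rw [Y_one_pow]
  exact Algebra.subset_adjoin (.inl (.inl (.inr (.inr (.inr rfl)))))

lemma convP_mem_generated {s : ℕ} (hs : s ≤ p ^ n) :
    convP lam (p ^ n) s ∈ generated lam (p ^ n) := by
  rcases lt_or_ge s 2 with h2 | h2
  · interval_cases s
    · exact convP_zero (p := p) (lam := lam) ▸ one_mem _
    · exact convP_one (p := p) (lam := lam) ▸ zero_mem _
  · exact Algebra.subset_adjoin (.inl (.inr ⟨s, h2, hs, (P_eq_convP lam h2).symm⟩))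

lemma inverse_Y_one_mem (hE : generated lam (p ^ n) ≤ E) (h1 : X lam (p ^ n) 1 ∈ E) :
    Ring.inverse (Y lam (p ^ n) 1) ∈ E := by
  have hu := isUnit_Y_of_char (p := p) (n := n) lam 1
  have h : Ring.inverse (Y lam (p ^ n) 1) =
      Y lam (p ^ n) 1 ^ (p ^ n - 1) * Ring.inverse (Y lam (p ^ n) 1 ^ p ^ n) := by
    rw [Ring.eq_mul_inverse_iff_mul_eq _ _ _ (hu.pow _),
      ← mul_pow_sub_one (pow_pos (Fact.out : p.Prime).pos n).ne',
      Ring.inverse_mul_cancel_left _ _ hu]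
  rw [h]
  exact mul_mem (pow_mem (Y_one_mem hE h1) _) (hE inverse_Y_one_pow_mem_generated)

lemma Y_mem (hE : generated lam (p ^ n) ≤ E) (h1 : X lam (p ^ n) 1 ∈ E) {s : ℕ} (hs : s < p ^ n) :
    Y lam (p ^ n) s ∈ E := by
  rcases lt_or_ge s 2 with h2 | h2
  · interval_cases s
    · exact Y_zero lam (p ^ n) ▸ hE X_zero_mem_generated
    · exact Y_one_mem hE h1
  · have hu := (isUnit_Y_of_char (p := p) (n := n) lam 1).pow s
    have hY := mul_mem (hE (Y_mul_inverse_mem_generated h2 hs)) (pow_mem (Y_one_mem hE h1) s)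
    rwa [mul_assoc, Ring.inverse_mul_cancel _ hu, mul_one] at hY

lemma Y_mul_umbral_convP (s : ℕ) : Y lam (p ^ n) s * umbral (convP lam (p ^ n))
      ((C (X lam (p ^ n) 0) + C (algebraMap R _ lam) * Polynomial.X) ^ s) =
    X lam (p ^ n) 0 * Y lam (p ^ n) 1 ^ s := by
  rw [Y_eq_umbral, Y_one]
  exact (isConvQuotient_convP (isUnit_Y_of_char lam)).umbral_mul_umbral s

lemma mem_of_mul_X_zero_mul_Y_one_pow_mem (hE : generated lam (p ^ n) ≤ E)
    (h1 : X lam (p ^ n) 1 ∈ E) {a : SA lam (p ^ n)} {s : ℕ}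
    (ha : a * (X lam (p ^ n) 0 * Y lam (p ^ n) 1 ^ s) ∈ E) : a ∈ E := by
  have h := mul_mem (mul_mem ha (hE inverse_X_zero_mem_generated))
    (pow_mem (inverse_Y_one_mem hE h1) s)
  have hX := Ring.mul_inverse_cancel _ (isUnit_X_zero (p := p) (n := n) lam)
  have hY := Ring.mul_inverse_cancel _ (isUnit_Y_of_char (p := p) (n := n) lam 1)
  rwa [mul_assoc, mul_assoc, mul_mul_mul_comm, ← mul_pow, hX, hY, one_pow, mul_one, mul_one] at h

lemma inverse_Y_mem (hE : generated lam (p ^ n) ≤ E) (h1 : X lam (p ^ n) 1 ∈ E) {s : ℕ}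
    (hs : s < p ^ n) : Ring.inverse (Y lam (p ^ n) s) ∈ E := by
  refine mem_of_mul_X_zero_mul_Y_one_pow_mem hE h1 (s := s) ?_
  rw [← Y_mul_umbral_convP, Ring.inverse_mul_cancel_left _ _ (isUnit_Y lam _ hs), umbral_add_pow]
  refine sum_mem fun k hk => ?_
  have hk := Finset.mem_range_succ_iff.1 hk
  exact mul_mem (mul_mem (mul_mem (natCast_mem E _) (pow_mem (Subalgebra.algebraMap_mem _ _) k))
    (pow_mem (hE X_zero_mem_generated) _)) (hE (convP_mem_generated (hk.trans hs.le)))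

lemma X_mem (hE : generated lam (p ^ n) ≤ E) (h1 : X lam (p ^ n) 1 ∈ E) {s : ℕ}
    (hs : s < p ^ n) : X lam (p ^ n) s ∈ E := by
  induction s using Nat.strong_induction_on with | _ s ih
  refine mem_of_mul_X_zero_mul_Y_one_pow_mem hE h1 (s := s) ?_
  rw [← Y_mul_umbral_convP, mul_left_comm]
  exact mul_mem (Y_mem hE h1 hs)
    ((isConvQuotient_convP (isUnit_Y_of_char lam)).mul_umbral_mem E.toSubring
      (Subalgebra.algebraMap_mem _ _) (hE X_zero_mem_generated) h1
      (fun j hj => ih j hj (hj.trans hs)) fun i hi => hE (convP_mem_generated (hi.trans hs.le)))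

lemma generated_sup_adjoin_X_one :
    generated lam (p ^ n) ⊔ Algebra.adjoin R {X lam (p ^ n) 1} = ⊤ := by
  have hE : generated lam (p ^ n) ≤ generated lam (p ^ n) ⊔ Algebra.adjoin R {X lam (p ^ n) 1} :=
    le_sup_left
  have h1 : X lam (p ^ n) 1 ∈ generated lam (p ^ n) ⊔ Algebra.adjoin R {X lam (p ^ n) 1} :=
    le_sup_right (a := generated lam (p ^ n)) (Algebra.self_mem_adjoin_singleton R _)
  exact eq_top_of_X_mem_of_inverse_Y_mem (fun _ hs => X_mem hE h1 hs)
    fun _ hs => inverse_Y_mem hE h1 hs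

variable (lam)

lemma coinvariants_le_generated : coinvariants lam (p ^ n) ≤ generated lam (p ^ n) := by
  intro a ha
  obtain ⟨q, hqN, hq, rfl⟩ := exists_eval_eq_of_pow_mem (generated_sup_adjoin_X_one (lam := lam))
    (pow_pos (Fact.out : p.Prime).pos n).ne' X_one_pow_mem_generated a
  have hC := eq_C_of_map_eval_eq (fun _ => eq_zero_of_aeval_truncT)
    (truncCoaction lam (p ^ n)).toRingHom (isUnit_Y_of_char lam 1) (truncCoaction_X_one lam) hqN
    (fun k => mem_coinvariants_iff.1 (generated_le_coinvariants lam (hq k)))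
    (mem_coinvariants_iff.1 ha)
  have h0 := hq 0
  rwa [hC, Polynomial.coeff_C_zero] at h0

end GenerationChar

end

end UnitGroupScheme

theorem proposition3p5 (p : ℕ) [Fact p.Prime] (n : ℕ) (hn : 0 < n)
    (R : Type*) [CommRing R] [Algebra (ZMod p) R] (lam : R) :
    (∀ s, 2 ≤ s → s ≤ p ^ n → ∃! q : UnitGroupScheme.SAPoly R (p ^ n),
      UnitGroupScheme.toSALaurent R (p ^ n) q = UnitGroupScheme.laurentP R (p ^ n) s) ∧
    UnitGroupScheme.coinvariants lam (p ^ n) = UnitGroupScheme.generated lam (p ^ n) := by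
  refine ⟨fun s hs _ => ⟨_, UnitGroupScheme.toSALaurent_convP R hs, fun q hq => ?_⟩,
    le_antisymm (UnitGroupScheme.coinvariants_le_generated lam)
      (UnitGroupScheme.generated_le_coinvariants lam)⟩
  exact UnitGroupScheme.toSALaurent_injective R _
    (hq.trans (UnitGroupScheme.toSALaurent_convP R hs).symm)
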